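/- **Notation.** For $0<q<1$ let $[n]_q=1+q+\dots+q^{n-1}$, $[n]_q!=[1]_q[2]_q\cdots[n]_q$, $\begin{bmatrix} n\\k\end{bmatrix}_q=\frac{[n]_q!}{[k]_q!\,[n-k]_q!}$, $(1+x)_q^n=\prod_{j=0}^{n-1}(1+q^jx)$, $e_q^{x}=\prod_{j=0}^{\infty}\bigl(1-(1-q)q^jx\bigr)^{-1}$, and for $B>0$ let $$\int_0^{\infty/B} g(t)\,d_qt=(1-q)\sum_{m\in\mathbb Z}\frac{q^m}{B}\,g\!\left(\frac{q^m}{B}\right).$$ Let $C^*_{x^2}[0,\infty)$ be the set of all continuous $f:[0,\infty)\to\mathbb R$ such that $|f(x)|\le M_f(1+x^2)$ for all $x\ge 0$, with a constant $M_f$, and such that $\lim_{x\to\infty}f(x)/(1+x^2)$ exists and is finite. For $n\ge1$, $p\in\mathbb N$ (including $p=0$), $a>0$ and $x\ge0$ the $q$-Baskakov-Schurer-Szász operator is $$\mathcal L^{q}_{n,p}(f,x)=[n+p]_q\sum_{k=0}^\infty \begin{bmatrix} n+p+k-1\\k\end{bmatrix}_q q^{k^2}\frac{x^k}{(1+x)_q^{n+p+k}}\int_0^{\infty/(a(1-q))}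 f(t)\,e_q^{-[n+p]_qt}\,\frac{([n+p]_qt)^k}{[k]_q!}\,d_qt .$$ **Theorem.** Let $p\in\mathbb N$, $a>0$, $A>0$, and let $(q_n)_{n\ge1}$ be a sequence in $(0,1)$. Then for all $f\in C^*_{x^2}[0,\infty)$, $n\ge1$ and $x\ge0$ the series (over $m$ and over $k$) that define $\mathcal L^{q_n}_{n,p}(f,x)$ converge absolutely. Moreover, $\mathcal L^{q_n}_{n,p}(f,\cdot)\to f$ uniformly on $[0,A]$ as $n\to\infty$ for every $f\in C^*_{x^2}[0,\infty)$ if and only if $\lim_{n\to\infty}q_n=1$. -/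

import Mathlib

noncomputable section

namespace QBSS

open Filter Topology

/-- The `q`-integer `[n]_q = 1 + q + ⋯ + q^(n-1)`. -/
def qInt (q : ℝ) (n : ℕ) : ℝ := ∑ i ∈ Finset.range n, q ^ i

/-- The `q`-factorial `[n]_q! = [1]_q [2]_q ⋯ [n]_q`. -/
def qFact (q : ℝ) (n : ℕ) : ℝ := ∏ i ∈ Finset.range n, qInt q (i + 1)

/-- The Gaussian binomial coefficient, for `k ≤ n`. -/
def qBinom (q : ℝ) (n k : ℕ) : ℝ := qFact q n / (qFact q k * qFact q (n - k))

/-- The `q`-shifted power `(1 + x)_q^n = (1 + x)(1 + q x) ⋯ (1 + q^(n-1) x)`. -/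
def qShiftPow (q x : ℝ) (n : ℕ) : ℝ := ∏ j ∈ Finset.range n, (1 + q ^ j * x)

/-- The `q`-exponential function `e_q^x = 1 / (1 - (1 - q) x)_q^∞`
(equal to `∑ x^k / [k]_q!` for `|x| < 1 / (1 - q)`). -/
def qExp (q x : ℝ) : ℝ := (∏' j : ℕ, (1 - (1 - q) * q ^ j * x))⁻¹

/-- The infinite product in the definition of `qExp` converges. -/
theorem multipliable_qExp {q : ℝ} (h0 : 0 < q) (h1 : q < 1) (x : ℝ) :
    Multipliable fun j : ℕ => 1 - (1 - q) * q ^ j * x := by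
  have hs : Summable fun j : ℕ => -((1 - q) * q ^ j * x) :=
    (((summable_geometric_of_lt_one h0.le h1).mul_left (1 - q)).mul_right x).neg
  simpa [sub_eq_add_neg] using Real.multipliable_one_add_of_summable hs

/-- The `m`-th term of the improper Jackson integral over `[0, ∞/B]`, apart from the
factor `1 - q`. -/
def jacksonTerm (q B : ℝ) (g : ℝ → ℝ) (m : ℤ) : ℝ := q ^ m / B * g (q ^ m / B)

/-- The improper Jackson `q`-integral
`∫_0^{∞/B} g(t) d_q t = (1 - q) ∑_{m ∈ ℤ} (q^m / B) g (q^m / B)`. -/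
def jacksonIntegral (q B : ℝ) (g : ℝ → ℝ) : ℝ := (1 - q) * ∑' m : ℤ, jacksonTerm q B g m

/-- The `q`-Baskakov-Schurer basis function `b^k_{n,p}(x; q)`. -/
def baskakovBasis (q : ℝ) (n p k : ℕ) (x : ℝ) : ℝ :=
  qBinom q (n + p + k - 1) k * q ^ (k ^ 2) * x ^ k / qShiftPow q x (n + p + k)

/-- The `q`-Szász basis function `s^k_{n,p}(t; q) = e_q^{-[n+p]_q t} ([n+p]_q t)^k / [k]_q!`. -/
def szaszBasis (q : ℝ) (n p k : ℕ) (t : ℝ) : ℝ :=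
  qExp q (-(qInt q (n + p) * t)) * (qInt q (n + p) * t) ^ k / qFact q k

/-- The `k`-th summand of the operator, apart from the factor `[n+p]_q`. -/
def operatorTerm (q a : ℝ) (n p : ℕ) (f : ℝ → ℝ) (x : ℝ) (k : ℕ) : ℝ :=
  baskakovBasis q n p k x *
    jacksonIntegral q (a * (1 - q)) (fun t => f t * szaszBasis q n p k t)

/-- The `q`-Baskakov-Schurer-Szász operator
`[n+p]_q ∑_k b^k_{n,p}(x; q) ∫_0^{∞/(a(1-q))} f(t) s^k_{n,p}(t; q) d_q t`. -/
def operator (q a : ℝ) (n p : ℕ) (f : ℝ → ℝ) (x : ℝ) : ℝ :=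
  qInt q (n + p) * ∑' k : ℕ, operatorTerm q a n p f x k

/-- All the series in the definition of the operator at `f` and `x` converge (absolutely). -/
def WellDefinedAt (q a : ℝ) (n p : ℕ) (f : ℝ → ℝ) (x : ℝ) : Prop :=
  (∀ k : ℕ, Summable (jacksonTerm q (a * (1 - q)) (fun t => f t * szaszBasis q n p k t))) ∧
    Summable (operatorTerm q a n p f x)

/-- The weighted space `C*_{x²}[0, ∞)`: the functions that are continuous on `[0, ∞)`, bounded
there by a multiple of `1 + x²`, and for which `f(x) / (1 + x²)` has a finite limit at infinity.
Only the values on `[0, ∞)` matter. -/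
def CStar : Set (ℝ → ℝ) :=
  {f | ContinuousOn f (Set.Ici 0) ∧
    (∃ M : ℝ, ∀ x ∈ Set.Ici (0 : ℝ), |f x| ≤ M * (1 + x ^ 2)) ∧
    ∃ l : ℝ, Tendsto (fun x => f x / (1 + x ^ 2)) atTop (𝓝 l)}

end QBSS

end

noncomputable section

namespace QBSS

open Filter Topology

/-! The argument is of Korovkin type. The operator is positive, and its values on 1, t, t² are exact
rational expressions in q, Y = [n+p]_q and x (`operator_quadratic`). The Jackson moments of the
q-Szász kernel carry a factor q^(-C(k+1,2)), which cancels part of q^(k²) and leaves the weights of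
a q-negative binomial distribution. Its total mass and two moments follow by telescoping and index
shifts.

Absolute convergence comes from comparison with ±M(1 + t²). If q_n → 1, then [n+p]_{q_n} → ∞, so the
second central moment tends to 0 uniformly on [0, A]; this suffices since |f(t) - f(x)| ≤ ε + C(t -
x)². Conversely, for f(t) = t the difference of the images at A and 0 is A/q_n², which forces q_n →
1. -/

theorem qInt_succ (q : ℝ) (n : ℕ) : qInt q (n + 1) = qInt q n + q ^ n :=
  Finset.sum_range_succ _ _

theorem qInt_succ' (q : ℝ) (n : ℕ) : qInt q (n + 1) = q * qInt q n + 1 := by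
  simp [qInt, Finset.sum_range_succ', Finset.mul_sum, pow_succ']

theorem qInt_add (q : ℝ) (m n : ℕ) : qInt q (m + n) = qInt q m + q ^ m * qInt q n := by
  simp [qInt, Finset.sum_range_add, Finset.mul_sum, pow_add]

theorem one_sub_mul_qInt (q : ℝ) (n : ℕ) : (1 - q) * qInt q n = 1 - q ^ n :=
  mul_neg_geom_sum q n

theorem qFact_zero (q : ℝ) : qFact q 0 = 1 := by simp [qFact]

theorem qFact_succ (q : ℝ) (n : ℕ) : qFact q (n + 1) = qFact q n * qInt q (n + 1) :=
  Finset.prod_range_succ _ _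

theorem qInt_succ_pos {q : ℝ} (h0 : 0 < q) (n : ℕ) : 0 < qInt q (n + 1) := by
  rw [qInt_succ']
  have : 0 ≤ qInt q n := Finset.sum_nonneg fun i _ => by positivity
  positivity

theorem qFact_pos {q : ℝ} (h0 : 0 < q) (n : ℕ) : 0 < qFact q n :=
  Finset.prod_pos fun i _ => qInt_succ_pos h0 i

theorem hasSum_of_eq {ι : Type*} {f g : ι → ℝ} {b c : ℝ} (h : HasSum f b) (hf : ∀ i, g i = f i)
    (hb : c = b) : HasSum g c := by
  rw [hb, show g = f from funext hf]
  exact h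

theorem choose_succ_two (k : ℕ) : (k + 1).choose 2 = k.choose 2 + k := by
  rw [Nat.choose_succ_succ' k 1, Nat.choose_one_right, add_comm]

/-! ### The `q`-exponential on the negative axis -/

theorem hasProd_qExp_neg {q : ℝ} (h0 : 0 < q) (h1 : q < 1) (u : ℝ) :
    Tendsto (fun n : ℕ => ∏ j ∈ Finset.range n, (1 + (1 - q) * q ^ j * u)) atTop
      (𝓝 (qExp q (-u))⁻¹) := by
  have h := (multipliable_qExp h0 h1 (-u)).hasProd.tendsto_prod_nat
  simpa [qExp] using h

theorem one_le_inv_qExp_neg {q : ℝ} (h0 : 0 < q) (h1 : q < 1) {u : ℝ} (hu : 0 ≤ u) :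
    1 ≤ (qExp q (-u))⁻¹ := by
  refine ge_of_tendsto' (hasProd_qExp_neg h0 h1 u) fun n => ?_
  refine Finset.one_le_prod fun j _ => ?_
  have : 0 < 1 - q := by linarith
  have : 0 ≤ (1 - q) * q ^ j * u := by positivity
  linarith

theorem qExp_neg_pos {q : ℝ} (h0 : 0 < q) (h1 : q < 1) {u : ℝ} (hu : 0 ≤ u) :
    0 < qExp q (-u) :=
  inv_pos.1 (zero_lt_one.trans_le (one_le_inv_qExp_neg h0 h1 hu))

/-- Peel the factor j = 0 off the infinite product. -/
theorem inv_qExp_neg_eq {q : ℝ} (h0 : 0 < q) (h1 : q < 1) (u : ℝ) :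
    (qExp q (-u))⁻¹ = (1 + (1 - q) * u) * (qExp q (-(q * u)))⁻¹ := by
  refine tendsto_nhds_unique ((tendsto_add_atTop_iff_nat 1).2 (hasProd_qExp_neg h0 h1 u)) ?_
  refine ((hasProd_qExp_neg h0 h1 (q * u)).const_mul (1 + (1 - q) * u)).congr fun n => ?_
  rw [Finset.prod_range_succ', mul_comm]
  congr 1
  · refine Finset.prod_congr rfl fun j _ => by ring
  · ring

theorem qExp_neg_mul {q : ℝ} (h0 : 0 < q) (h1 : q < 1) {u : ℝ} (hu : 0 ≤ u) :
    qExp q (-(q * u)) = (1 + (1 - q) * u) * qExp q (-u) := by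
  have h := inv_qExp_neg_eq h0 h1 u
  have p1 := qExp_neg_pos h0 h1 hu
  have p2 := qExp_neg_pos h0 h1 (mul_nonneg h0.le hu)
  rw [← div_eq_mul_inv, inv_eq_one_div, div_eq_div_iff p1.ne' p2.ne'] at h
  linarith

theorem qExp_neg_pow_mul {q : ℝ} (h0 : 0 < q) (h1 : q < 1) {u : ℝ} (hu : 0 ≤ u) (n : ℕ) :
    qExp q (-(q ^ n * u)) =
      (∏ j ∈ Finset.range n, (1 + (1 - q) * q ^ j * u)) * qExp q (-u) := by
  induction n with
  | zero => simp
  | succ n ih =>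
    rw [Finset.prod_range_succ, pow_succ', mul_assoc, qExp_neg_mul h0 h1 (by positivity), ih]
    ring

theorem tendsto_qExp_neg_zero {q : ℝ} (h0 : 0 < q) (h1 : q < 1) {u : ℝ} (hu : 0 ≤ u) :
    Tendsto (fun n : ℕ => qExp q (-(q ^ n * u))) atTop (𝓝 1) := by
  have h := (hasProd_qExp_neg h0 h1 u).mul_const (qExp q (-u))
  rw [inv_mul_cancel₀ (qExp_neg_pos h0 h1 hu).ne'] at h
  exact h.congr fun n => (qExp_neg_pow_mul h0 h1 hu n).symm

theorem tendsto_qExp_neg_atTop {q : ℝ} (h0 : 0 < q) (h1 : q < 1) {u : ℝ} (hu : 0 < u) :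
    Tendsto (fun n : ℕ => qExp q (-((q ^ n)⁻¹ * u))) atTop (𝓝 0) := by
  have hq : 0 < 1 - q := by linarith
  have ht : Tendsto (fun n : ℕ => (1 - q) * u * q⁻¹ ^ n) atTop atTop :=
    (tendsto_pow_atTop_atTop_of_one_lt ((one_lt_inv₀ h0).2 h1)).const_mul_atTop (by positivity)
  have ht' : Tendsto (fun n : ℕ => (qExp q (-((q ^ n)⁻¹ * u)))⁻¹) atTop atTop := by
    refine tendsto_atTop_mono (fun n => ?_) ht
    have hn : 0 ≤ (q ^ n)⁻¹ * u := by positivity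
    rw [inv_qExp_neg_eq h0 h1]
    have h3 := one_le_inv_qExp_neg h0 h1 (mul_nonneg h0.le hn)
    have h4 : 0 ≤ (1 - q) * ((q ^ n)⁻¹ * u) := by positivity
    calc (1 - q) * u * q⁻¹ ^ n = (1 - q) * ((q ^ n)⁻¹ * u) := by rw [inv_pow]; ring
      _ ≤ 1 + (1 - q) * ((q ^ n)⁻¹ * u) := by linarith
      _ ≤ _ := le_mul_of_one_le_right (by linarith) h3
  exact ht'.inv_tendsto_atTop.congr fun n => inv_inv _

/-! ### The moments of the improper Jackson integral -/

theorem hasSum_int_telescope {e : ℤ → ℝ} (he : Monotone e) {b c : ℝ}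
    (hb : Tendsto (fun n : ℕ => e n) atTop (𝓝 b))
    (hc : Tendsto (fun n : ℕ => e (-n)) atTop (𝓝 c)) :
    HasSum (fun m : ℤ => e (m + 1) - e m) (b - c) := by
  have hn : ∀ m : ℤ, 0 ≤ e (m + 1) - e m := fun m => sub_nonneg.2 (he (by lia))
  have h1 : HasSum (fun n : ℕ => e ((n : ℤ) + 1) - e n) (b - e 0) := by
    rw [hasSum_iff_tendsto_nat_of_nonneg (fun n => hn n)]
    refine (hb.sub_const (e 0)).congr fun n => ?_
    have := Finset.sum_range_sub (fun n : ℕ => e n) n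
    push_cast at this
    exact this.symm
  have h2 : HasSum (fun n : ℕ => e (-((n : ℤ) + 1) + 1) - e (-((n : ℤ) + 1))) (e 0 - c) := by
    rw [hasSum_iff_tendsto_nat_of_nonneg (fun n => hn _)]
    refine (hc.const_sub (e 0)).congr fun n => ?_
    have := Finset.sum_range_sub' (fun n : ℕ => e (-n)) n
    push_cast at this
    rw [neg_zero] at this
    rw [← this]
    refine Finset.sum_congr rfl fun i _ => ?_
    congr 2
    ring
  have := HasSum.of_nat_of_neg_add_one (f := fun m : ℤ => e (m + 1) - e m) h1 h2
  simpa using this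

/-- With E(u) = e_q^(-u), the functional equation reads (1 - q) u E(u) = E(qu) - E(u). For k = 0 the
sum telescopes. For the induction step, multiply by u^(k+1) and shift m, which yields the factor
[k+1]_q / q^(k+1). The value does not depend on c. -/
theorem hasSum_jackson_moment {q : ℝ} (h0 : 0 < q) (h1 : q < 1) {c : ℝ} (hc : 0 < c) (k : ℕ) :
    HasSum (fun m : ℤ => (q ^ m * c) ^ (k + 1) * qExp q (-(q ^ m * c)))
      (qFact q k / ((1 - q) * q ^ ((k + 1).choose 2))) := by
  have hq : 0 < 1 - q := by linarith
  have hu : ∀ m : ℤ, 0 < q ^ m * c := fun m => by positivity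
  have hs : ∀ m : ℤ, qExp q (-(q ^ (m + 1) * c))
      = (1 + (1 - q) * (q ^ m * c)) * qExp q (-(q ^ m * c)) := fun m => by
    rw [zpow_add_one₀ h0.ne', mul_comm _ q, mul_assoc, qExp_neg_mul h0 h1 (hu m).le]
  induction k with
  | zero =>
    have hmono : Monotone fun m : ℤ => qExp q (-(q ^ m * c)) := by
      refine monotone_int_of_le_succ fun m => ?_
      rw [hs]
      have := hu m
      exact le_mul_of_one_le_left (qExp_neg_pos h0 h1 (hu m).le).le
        (le_add_of_nonneg_right (by positivity))
    have h := hasSum_int_telescope hmono (b := 1) (c := 0)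
      (by simpa using tendsto_qExp_neg_zero h0 h1 hc.le)
      (by simpa using tendsto_qExp_neg_atTop h0 h1 hc)
    refine hasSum_of_eq (h.div_const (1 - q)) (fun m => ?_) ?_
    · rw [hs]
      field_simp
      ring
    · simp [qFact_zero]
  | succ k ih =>
    have h2 := ((Equiv.addRight (1 : ℤ)).hasSum_iff).2 ih
    have h := ((h2.div_const (q ^ (k + 1))).sub ih).div_const (1 - q)
    refine hasSum_of_eq h (fun m => ?_) ?_
    · simp only [Function.comp, Equiv.coe_addRight]
      rw [hs, zpow_add_one₀ h0.ne']
      field_simp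
      ring
    · rw [qFact_succ, choose_succ_two (k + 1)]
      have := one_sub_mul_qInt q (k + 1)
      have e : qInt q (k + 1) = (1 - q ^ (k + 1)) / (1 - q) := by
        field_simp; linarith
      rw [e]
      field_simp
      ring

/-! ### The `q`-negative binomial distribution -/

/-- The weights of the `q`-negative binomial distribution with `r + 1` successes. -/
def negBinom (q x : ℝ) (r k : ℕ) : ℝ :=
  qFact q (r + k) / (qFact q k * qFact q r) * q ^ (k.choose 2) * x ^ k /
    qShiftPow q x (r + 1 + k)

/-- The quotient `[k]_q / q^k`. -/
def qRatio (q : ℝ) (k : ℕ) : ℝ := qInt q k / q ^ k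

theorem qShiftPow_succ (q x : ℝ) (n : ℕ) :
    qShiftPow q x (n + 1) = qShiftPow q x n * (1 + q ^ n * x) :=
  Finset.prod_range_succ _ _

theorem qShiftPow_pos {q x : ℝ} (h0 : 0 < q) (hx : 0 ≤ x) (n : ℕ) : 0 < qShiftPow q x n :=
  Finset.prod_pos fun i _ => by positivity

theorem negBinom_nonneg {q x : ℝ} (h0 : 0 < q) (hx : 0 ≤ x) (r k : ℕ) :
    0 ≤ negBinom q x r k := by
  have := qFact_pos h0 (r + k)
  have := qFact_pos h0 k
  have := qFact_pos h0 r
  have := qShiftPow_pos h0 hx (r + 1 + k)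
  unfold negBinom
  positivity

theorem qInt_le {q : ℝ} (h0 : 0 < q) (h1 : q < 1) (n : ℕ) : qInt q n ≤ (1 - q)⁻¹ := by
  have hq : 0 < 1 - q := by linarith
  rw [← one_div, le_div_iff₀ hq, mul_comm, one_sub_mul_qInt]
  linarith [pow_pos h0 n]

theorem hasSum_negBinom_zero {q x : ℝ} (h0 : 0 < q) (h1 : q < 1) (hx : 0 ≤ x) :
    HasSum (negBinom q x 0) 1 := by
  -- The k-th weight is R k - R (k + 1), and R tends to 0.
  set R : ℕ → ℝ := fun k => q ^ (k.choose 2) * x ^ k / qShiftPow q x k with hR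
  have hR0 : R 0 = 1 := by simp [hR, qShiftPow]
  have hRs : ∀ k, R (k + 1) = R k * (q ^ k * x / (1 + q ^ k * x)) := fun k => by
    have := qShiftPow_pos h0 hx k
    have : 0 < 1 + q ^ k * x := by positivity
    simp only [hR, choose_succ_two, qShiftPow_succ]
    field_simp
    ring
  have hRn : ∀ k, 0 ≤ R k := fun k => by
    have := qShiftPow_pos h0 hx k
    positivity
  have hR1 : ∀ k, R k ≤ 1 := fun k => by
    induction k with
    | zero => exact hR0.le
    | succ k ih =>
      rw [hRs]
      refine mul_le_one₀ ih (by positivity) ?_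
      rw [div_le_one (by positivity)]
      linarith
  have hlim : Tendsto R atTop (𝓝 0) := by
    rw [← tendsto_add_atTop_iff_nat 1]
    have hg : Tendsto (fun k : ℕ => q ^ k * x) atTop (𝓝 0) := by
      simpa using (tendsto_pow_atTop_nhds_zero_of_lt_one h0.le h1).mul_const x
    refine squeeze_zero (fun k => hRn _) (fun k => ?_) hg
    rw [hRs]
    have hk : 0 ≤ q ^ k * x := by positivity
    calc _ ≤ 1 * (q ^ k * x / (1 + q ^ k * x)) :=
          mul_le_mul_of_nonneg_right (hR1 k) (by positivity)
      _ ≤ q ^ k * x := by rw [one_mul]; exact div_le_self hk (by linarith)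
  rw [hasSum_iff_tendsto_nat_of_nonneg (negBinom_nonneg h0 hx 0)]
  have hsum : ∀ n, ∑ k ∈ Finset.range n, negBinom q x 0 k = 1 - R n := fun n => by
    rw [← hR0, ← Finset.sum_range_sub']
    refine Finset.sum_congr rfl fun k _ => ?_
    rw [hRs]
    have := qShiftPow_pos h0 hx k
    have := qFact_pos h0 k
    have : 0 < 1 + q ^ k * x := by positivity
    simp only [hR, negBinom, zero_add, qFact_zero, add_comm 1 k, qShiftPow_succ]
    field_simp
    ring
  simp only [hsum]
  simpa using hlim.const_sub 1

theorem hasSum_negBinom {q x : ℝ} (h0 : 0 < q) (h1 : q < 1) (hx : 0 ≤ x) (r : ℕ) :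
    HasSum (negBinom q x r) 1 := by
  induction r with
  | zero => exact hasSum_negBinom_zero h0 h1 hx
  | succ r ih =>
    -- U makes the difference between the distributions for r and r + 1 telescope, up to an index
    -- shift; it vanishes at infinity because [n]_q ≤ 1/(1 - q).
    set U : ℕ → ℝ := fun k => negBinom q x r k * (qInt q (r + 1 + k) / qInt q (r + 1)) with hU
    have hr := qInt_succ_pos h0 r
    have hU0 : U 0 = negBinom q x r 0 := by simp [hU, hr.ne']
    have hUs : ∀ k, U (k + 1) - U k = negBinom q x r (k + 1) - negBinom q x (r + 1) k := by
      intro k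
      have e1 : r + 1 + (k + 1) = r + 1 + k + 1 := by ring
      have e2 : r + (k + 1) = r + k + 1 := by ring
      have e3 : r + 1 + 1 + k = r + 1 + k + 1 := by ring
      have e4 : r + 1 + k = r + k + 1 := by ring
      have hS := qShiftPow_pos h0 hx (r + 1 + k)
      have hf1 := qFact_pos h0 k
      have hf2 := qFact_pos h0 r
      have hf3 := qFact_pos h0 (r + k)
      have hk := qInt_succ_pos h0 k
      have hx' : 0 < 1 + q ^ (r + 1 + k) * x := by positivity
      have ha : qInt q (r + 1 + k + 1) = qInt q (r + 1) + q ^ (r + 1) * qInt q (k + 1) := by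
        rw [← qInt_add]; rfl
      simp only [hU, negBinom, e1, e2, e3, qShiftPow_succ, qFact_succ, choose_succ_two, ha]
      rw [show qFact q (r + 1 + k) = qFact q (r + k) * qInt q (r + 1 + k) by
        rw [e4, qFact_succ], show qInt q (r + k + 1) = qInt q (r + 1 + k) by rw [e4]]
      field_simp
      ring
    have hlim : Tendsto U atTop (𝓝 0) := by
      have hz : Tendsto (fun k => negBinom q x r k * ((1 - q)⁻¹ / qInt q (r + 1))) atTop (𝓝 0) := by
        simpa using ih.summable.tendsto_atTop_zero.mul_const ((1 - q)⁻¹ / qInt q (r + 1))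
      have hn := negBinom_nonneg h0 hx r
      refine squeeze_zero (fun k => ?_) (fun k => ?_) hz
      · have : 0 < qInt q (r + 1 + k) := by
          rw [show r + 1 + k = r + k + 1 by ring]; exact qInt_succ_pos h0 _
        exact mul_nonneg (hn k) (by positivity)
      · exact mul_le_mul_of_nonneg_left (by gcongr; exact qInt_le h0 h1 _) (hn k)
    have hsum : ∀ n, ∑ k ∈ Finset.range n, negBinom q x (r + 1) k
        = ∑ k ∈ Finset.range (n + 1), negBinom q x r k - U n := fun n => by
      induction n with
      | zero => simp [hU0]
      | succ n ihn =>
        rw [Finset.sum_range_succ, ihn, Finset.sum_range_succ _ (n + 1)]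
        linarith [hUs n]
    rw [hasSum_iff_tendsto_nat_of_nonneg (negBinom_nonneg h0 hx _)]
    simp only [hsum]
    simpa using ((tendsto_add_atTop_iff_nat 1).2 ih.tendsto_sum_nat).sub hlim

theorem qRatio_zero (q : ℝ) : qRatio q 0 = 0 := by simp [qRatio, qInt]

theorem qRatio_succ {q : ℝ} (h0 : 0 < q) (k : ℕ) : qRatio q (k + 1) = (qRatio q k + 1) / q := by
  rw [qRatio, qRatio, div_eq_div_iff (by positivity) (by positivity), qInt_succ]
  field_simp
  ring

/-- Size biasing: each factor [k]_q / q^k trades one unit of k for one unit of r, so moments reduce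
to total masses. -/
theorem negBinom_succ_mul_qRatio {q x : ℝ} (h0 : 0 < q) (hx : 0 ≤ x) (r k : ℕ) :
    negBinom q x r (k + 1) * qRatio q (k + 1) =
      qInt q (r + 1) * x / q * negBinom q x (r + 1) k := by
  have hS := qShiftPow_pos h0 hx (r + 1 + k + 1)
  have hf1 := qFact_pos h0 k
  have hf2 := qFact_pos h0 r
  have hk := qInt_succ_pos h0 k
  have hr := qInt_succ_pos h0 r
  rw [negBinom, negBinom, qRatio, show r + 1 + (k + 1) = r + 1 + k + 1 by ring,
    show r + 1 + 1 + k = r + 1 + k + 1 by ring, show r + (k + 1) = r + 1 + k by ring,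
    choose_succ_two, qFact_succ q k, qFact_succ q r]
  field_simp
  ring

theorem hasSum_negBinom_mul_qRatio {q x : ℝ} (h0 : 0 < q) (h1 : q < 1) (hx : 0 ≤ x) (r : ℕ) :
    HasSum (fun k => negBinom q x r k * qRatio q k) (qInt q (r + 1) * x / q) := by
  rw [← hasSum_nat_add_iff' 1]
  simp only [negBinom_succ_mul_qRatio h0 hx, Finset.sum_range_one, qRatio_zero]
  simpa using (hasSum_negBinom h0 h1 hx (r + 1)).mul_left (qInt q (r + 1) * x / q)

theorem hasSum_negBinom_mul_qRatio_sq {q x : ℝ} (h0 : 0 < q) (h1 : q < 1) (hx : 0 ≤ x) (r : ℕ) :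
    HasSum (fun k => negBinom q x r k * qRatio q k ^ 2)
      (qInt q (r + 1) * x / q ^ 2 * (qInt q (r + 2) * x / q + 1)) := by
  rw [← hasSum_nat_add_iff' 1]
  have h := ((hasSum_negBinom_mul_qRatio h0 h1 hx (r + 1)).add
    (hasSum_negBinom h0 h1 hx (r + 1))).mul_left (qInt q (r + 1) * x / q ^ 2)
  refine hasSum_of_eq h (fun k => ?_) ?_
  · rw [sq, ← mul_assoc, negBinom_succ_mul_qRatio h0 hx, qRatio_succ h0]
    field_simp
  · simp [qRatio_zero]

/-! ### The operator on quadratic polynomials -/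

theorem hasSum_jacksonTerm_quadratic {q a : ℝ} (h0 : 0 < q) (h1 : q < 1) (ha : 0 < a)
    {n p r : ℕ} (hr : n + p = r + 1) (k : ℕ) (α β γ : ℝ) :
    HasSum (jacksonTerm q (a * (1 - q)) fun t => (α + β * t + γ * t ^ 2) * szaszBasis q n p k t)
      ((α + β * qRatio q (k + 1) / qInt q (r + 1) +
        γ * (qRatio q (k + 1) * qRatio q (k + 2)) / qInt q (r + 1) ^ 2) /
          (qInt q (r + 1) * (1 - q) * q ^ (k + 1).choose 2)) := by
  have hq : 0 < 1 - q := by linarith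
  have hY := qInt_succ_pos h0 r
  have hk := qFact_pos h0 k
  set Y := qInt q (r + 1) with hYdef
  -- In the variable u = Y t the nodes are q^m c for this c; the moments ignore c, so a drops out.
  have hc : 0 < Y / (a * (1 - q)) := by positivity
  have h := (((hasSum_jackson_moment h0 h1 hc k).mul_left (α / (Y * qFact q k))).add
    ((hasSum_jackson_moment h0 h1 hc (k + 1)).mul_left (β / (Y ^ 2 * qFact q k)))).add
    ((hasSum_jackson_moment h0 h1 hc (k + 2)).mul_left (γ / (Y ^ 3 * qFact q k)))
  refine hasSum_of_eq h (fun m => ?_) ?_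
  · rw [jacksonTerm, szaszBasis, hr, ← hYdef]
    have e : Y * (q ^ m / (a * (1 - q))) = q ^ m * (Y / (a * (1 - q))) := by ring
    have e' : q ^ m / (a * (1 - q)) = q ^ m * (Y / (a * (1 - q))) / Y := by field_simp
    rw [e, e']
    generalize q ^ m * (Y / (a * (1 - q))) = u
    generalize qExp q (-u) = E
    field_simp
    ring
  · rw [choose_succ_two (k + 2), choose_succ_two (k + 1), qFact_succ q (k + 1), qFact_succ q k,
      qRatio, qRatio]
    field_simp
    ring

/-- Uses k² = C(k,2) + C(k+1,2); the second power of q cancels against the Jackson moments. -/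
theorem baskakovBasis_eq {q x : ℝ} {n p r : ℕ} (hr : n + p = r + 1) (k : ℕ) :
    baskakovBasis q n p k x = negBinom q x r k * q ^ (k + 1).choose 2 := by
  have e : k ^ 2 = k.choose 2 + (k + 1).choose 2 := by
    induction k with
    | zero => rfl
    | succ k ih =>
      rw [choose_succ_two (k + 1)]
      nlinarith [choose_succ_two k]
  rw [baskakovBasis, negBinom, qBinom, hr, show r + 1 + k - 1 = r + k by lia,
    show r + k - k = r by lia, e, pow_add]
  ring

/-- The first moment of the operator. -/
def firstMoment (q Y x : ℝ) : ℝ := x / q ^ 2 + 1 / (q * Y)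

/-- The second moment of the operator. -/
def secondMoment (q Y x : ℝ) : ℝ :=
  ((q + 1 / Y) * x ^ 2 / q ^ 3 + x / (q ^ 2 * Y) + (2 + q) * x / (q * Y) + (1 + q) / Y ^ 2) / q ^ 3

theorem hasSum_operatorTerm_quadratic {q a x : ℝ} (h0 : 0 < q) (h1 : q < 1) (ha : 0 < a)
    (hx : 0 ≤ x) {n p r : ℕ} (hr : n + p = r + 1) (α β γ : ℝ) :
    HasSum (operatorTerm q a n p (fun t => α + β * t + γ * t ^ 2) x)
      ((α + β * firstMoment q (qInt q (n + p)) x + γ * secondMoment q (qInt q (n + p)) x) /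
        qInt q (n + p)) := by
  have hq : 0 < 1 - q := by linarith
  have hY := qInt_succ_pos h0 r
  rw [hr]
  have hY2 : qInt q (r + 2) = q * qInt q (r + 1) + 1 := qInt_succ' q (r + 1)
  have h := (((hasSum_negBinom h0 h1 hx r).mul_left
      ((α + β / (q * qInt q (r + 1)) + γ * (1 + q) / (q ^ 3 * qInt q (r + 1) ^ 2)) /
        qInt q (r + 1))).add
    ((hasSum_negBinom_mul_qRatio h0 h1 hx r).mul_left
      ((β / (q * qInt q (r + 1)) + γ * (2 + q) / (q ^ 3 * qInt q (r + 1) ^ 2)) /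
        qInt q (r + 1)))).add
    ((hasSum_negBinom_mul_qRatio_sq h0 h1 hx r).mul_left
      (γ / (q ^ 3 * qInt q (r + 1) ^ 2) / qInt q (r + 1)))
  refine hasSum_of_eq h (fun k => ?_) ?_
  · rw [operatorTerm, jacksonIntegral, baskakovBasis_eq hr,
      (hasSum_jacksonTerm_quadratic h0 h1 ha hr k α β γ).tsum_eq, qRatio_succ h0 (k + 1),
      qRatio_succ h0 k]
    generalize qInt q (r + 1) = Y at *
    field_simp
    ring
  · rw [hY2, firstMoment, secondMoment]
    generalize qInt q (r + 1) = Y at *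
    field_simp
    ring

theorem operator_quadratic {q a x : ℝ} (h0 : 0 < q) (h1 : q < 1) (ha : 0 < a)
    (hx : 0 ≤ x) {n p r : ℕ} (hr : n + p = r + 1) (α β γ : ℝ) :
    operator q a n p (fun t => α + β * t + γ * t ^ 2) x =
      α + β * firstMoment q (qInt q (n + p)) x + γ * secondMoment q (qInt q (n + p)) x := by
  have hY : qInt q (n + p) ≠ 0 := by rw [hr]; exact (qInt_succ_pos h0 r).ne'
  rw [operator, (hasSum_operatorTerm_quadratic h0 h1 ha hx hr α β γ).tsum_eq,
    mul_div_cancel₀ _ hY]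

theorem wellDefinedAt_quadratic {q a x : ℝ} (h0 : 0 < q) (h1 : q < 1) (ha : 0 < a)
    (hx : 0 ≤ x) {n p r : ℕ} (hr : n + p = r + 1) (α β γ : ℝ) :
    WellDefinedAt q a n p (fun t => α + β * t + γ * t ^ 2) x :=
  ⟨fun k => (hasSum_jacksonTerm_quadratic h0 h1 ha hr k α β γ).summable,
    (hasSum_operatorTerm_quadratic h0 h1 ha hx hr α β γ).summable⟩

/-! ### Monotonicity and well-definedness -/

theorem szaszBasis_nonneg {q t : ℝ} (h0 : 0 < q) (h1 : q < 1) (ht : 0 ≤ t) (n p k : ℕ) :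
    0 ≤ szaszBasis q n p k t := by
  have hY : 0 ≤ qInt q (n + p) := Finset.sum_nonneg fun i _ => by positivity
  have h := qExp_neg_pos h0 h1 (mul_nonneg hY ht)
  have := qFact_pos h0 k
  unfold szaszBasis
  positivity

theorem baskakovBasis_nonneg {q x : ℝ} (h0 : 0 < q) (hx : 0 ≤ x) (n p k : ℕ) :
    0 ≤ baskakovBasis q n p k x := by
  have := qFact_pos h0 (n + p + k - 1)
  have := qFact_pos h0 (n + p + k - 1 - k)
  have := qFact_pos h0 k
  have := qShiftPow_pos h0 hx (n + p + k)
  unfold baskakovBasis qBinom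
  positivity

theorem jacksonTerm_le {q a : ℝ} (h0 : 0 < q) (h1 : q < 1) (ha : 0 < a) {f g : ℝ → ℝ}
    (hfg : ∀ t, 0 ≤ t → f t ≤ g t) (n p k : ℕ) (m : ℤ) :
    jacksonTerm q (a * (1 - q)) (fun t => f t * szaszBasis q n p k t) m ≤
      jacksonTerm q (a * (1 - q)) (fun t => g t * szaszBasis q n p k t) m := by
  have hq : 0 < 1 - q := by linarith
  have ht : 0 ≤ q ^ m / (a * (1 - q)) := by positivity
  exact mul_le_mul_of_nonneg_left
    (mul_le_mul_of_nonneg_right (hfg _ ht) (szaszBasis_nonneg h0 h1 ht n p k)) ht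

theorem operatorTerm_le {q a x : ℝ} (h0 : 0 < q) (h1 : q < 1) (ha : 0 < a) (hx : 0 ≤ x)
    {f g : ℝ → ℝ} (hfg : ∀ t, 0 ≤ t → f t ≤ g t) {n p k : ℕ}
    (hf : Summable (jacksonTerm q (a * (1 - q)) fun t => f t * szaszBasis q n p k t))
    (hg : Summable (jacksonTerm q (a * (1 - q)) fun t => g t * szaszBasis q n p k t)) :
    operatorTerm q a n p f x k ≤ operatorTerm q a n p g x k :=
  mul_le_mul_of_nonneg_left
    (mul_le_mul_of_nonneg_left (hf.tsum_le_tsum (jacksonTerm_le h0 h1 ha hfg n p k) hg)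
      (by linarith)) (baskakovBasis_nonneg h0 hx n p k)

theorem operator_mono {q a x : ℝ} (h0 : 0 < q) (h1 : q < 1) (ha : 0 < a) (hx : 0 ≤ x)
    {f g : ℝ → ℝ} (hfg : ∀ t, 0 ≤ t → f t ≤ g t) {n p : ℕ}
    (hf : WellDefinedAt q a n p f x) (hg : WellDefinedAt q a n p g x) :
    operator q a n p f x ≤ operator q a n p g x :=
  mul_le_mul_of_nonneg_left
    (hf.2.tsum_le_tsum (fun k => operatorTerm_le h0 h1 ha hx hfg (hf.1 k) (hg.1 k)) hg.2)
    (Finset.sum_nonneg fun i _ => by positivity)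

theorem wellDefinedAt_of_abs_le {q a x : ℝ} (h0 : 0 < q) (h1 : q < 1) (ha : 0 < a)
    (hx : 0 ≤ x) {n p r : ℕ} (hr : n + p = r + 1) {f : ℝ → ℝ} {M : ℝ}
    (hf : ∀ t, 0 ≤ t → |f t| ≤ M * (1 + t ^ 2)) : WellDefinedAt q a n p f x := by
  have hu : ∀ t, 0 ≤ t → f t ≤ M + 0 * t + M * t ^ 2 := fun t ht => by
    linarith [(abs_le.1 (hf t ht)).2]
  have hl : ∀ t, 0 ≤ t → -M + 0 * t + -M * t ^ 2 ≤ f t := fun t ht => by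
    linarith [(abs_le.1 (hf t ht)).1]
  have hU := wellDefinedAt_quadratic h0 h1 ha hx hr M 0 M
  have hL := wellDefinedAt_quadratic h0 h1 ha hx hr (-M) 0 (-M)
  have squeeze : ∀ {ι : Type} {u v w : ι → ℝ}, Summable u → Summable w →
      (∀ i, u i ≤ v i) → (∀ i, v i ≤ w i) → Summable v := by
    intro ι u v w hu hw huv hvw
    have h : Summable fun i => v i - u i :=
      Summable.of_nonneg_of_le (fun i => sub_nonneg.2 (huv i))
        (fun i => sub_le_sub_right (hvw i) _) (hw.sub hu)
    simpa using h.add hu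
  have h1' : ∀ k, Summable (jacksonTerm q (a * (1 - q)) fun t => f t * szaszBasis q n p k t) :=
    fun k => squeeze (hL.1 k) (hU.1 k) (jacksonTerm_le h0 h1 ha hl n p k)
      (jacksonTerm_le h0 h1 ha hu n p k)
  exact ⟨h1', squeeze hL.2 hU.2 (fun k => operatorTerm_le h0 h1 ha hx hl (hL.1 k) (h1' k))
    (fun k => operatorTerm_le h0 h1 ha hx hu (h1' k) (hU.1 k))⟩

/-! ### Convergence -/

theorem CStar.abs_sub_le {f : ℝ → ℝ} (hf : f ∈ CStar) (A : ℝ) {ε : ℝ} (hε : 0 < ε) :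
    ∃ C : ℝ, 0 ≤ C ∧ ∀ x ∈ Set.Icc 0 A, ∀ t, 0 ≤ t → |f t - f x| ≤ ε + C * (t - x) ^ 2 := by
  obtain ⟨hc, ⟨M, hM⟩, -⟩ := hf
  have hM0 : 0 ≤ M := by
    have := (abs_nonneg _).trans (hM 0 (Set.mem_Ici.2 le_rfl))
    simpa using this
  have huc : UniformContinuousOn f (Set.Icc 0 (A + 1)) :=
    isCompact_Icc.uniformContinuousOn_of_continuous (hc.mono fun x hx => hx.1)
  obtain ⟨δ, hδ, h⟩ := Metric.uniformContinuousOn_iff.1 huc ε hε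
  -- d ≤ 1 keeps t in [0, A + 1], where f is uniformly continuous.
  set d := min δ 1 with hd
  have hd0 : 0 < d := lt_min hδ one_pos
  refine ⟨M * (2 + 3 * A ^ 2) / d ^ 2 + 2 * M, by positivity, fun x hx t ht => ?_⟩
  rcases lt_or_ge |t - x| d with hlt | hge
  · have h1 : |t - x| < 1 := hlt.trans_le (min_le_right _ _)
    have ht' : t ∈ Set.Icc 0 (A + 1) := ⟨ht, by linarith [hx.2, (abs_lt.1 h1).2]⟩
    have := h t ht' x ⟨hx.1, by linarith [hx.2]⟩
      (by rw [Real.dist_eq]; exact hlt.trans_le (min_le_left _ _))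
    rw [Real.dist_eq] at this
    have : 0 ≤ (M * (2 + 3 * A ^ 2) / d ^ 2 + 2 * M) * (t - x) ^ 2 := by positivity
    linarith
  · have hsq : d ^ 2 ≤ (t - x) ^ 2 := by
      rw [← sq_abs (t - x)]
      gcongr
    have h1 : M * (2 + 3 * A ^ 2) ≤ M * (2 + 3 * A ^ 2) / d ^ 2 * (t - x) ^ 2 := by
      rw [div_mul_eq_mul_div, le_div_iff₀ (by positivity)]
      gcongr
    have h2 : |f t - f x| ≤ M * (1 + t ^ 2) + M * (1 + x ^ 2) :=
      (abs_sub _ _).trans (add_le_add (hM t ht) (hM x hx.1))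
    have h3 : x ^ 2 ≤ A ^ 2 := pow_le_pow_left₀ hx.1 hx.2 2
    have h4 : M * (1 + t ^ 2) + M * (1 + x ^ 2) ≤ M * (2 + 3 * A ^ 2 + 2 * (t - x) ^ 2) := by
      rw [← mul_add]
      refine mul_le_mul_of_nonneg_left ?_ hM0
      nlinarith [sq_nonneg (t - 2 * x)]
    linarith

/-- A bound for the second central moment of the operator on `[0, A]`. -/
def centralBound (A q z : ℝ) : ℝ :=
  A ^ 2 * |q⁻¹ ^ 5 + q⁻¹ ^ 6 * z - 2 * q⁻¹ ^ 2 + 1| +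
    A * |q⁻¹ ^ 5 * z + (2 + q) * q⁻¹ ^ 4 * z - 2 * q⁻¹ * z| + |(1 + q) * q⁻¹ ^ 3 * z ^ 2|

theorem centralMoment_le {A q Y x : ℝ} (hq : 0 < q) (hY : 0 < Y) (hx : x ∈ Set.Icc 0 A) :
    x ^ 2 - 2 * x * firstMoment q Y x + secondMoment q Y x ≤ centralBound A q Y⁻¹ := by
  have e : x ^ 2 - 2 * x * firstMoment q Y x + secondMoment q Y x =
      x ^ 2 * (q⁻¹ ^ 5 + q⁻¹ ^ 6 * Y⁻¹ - 2 * q⁻¹ ^ 2 + 1) +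
      x * (q⁻¹ ^ 5 * Y⁻¹ + (2 + q) * q⁻¹ ^ 4 * Y⁻¹ - 2 * q⁻¹ * Y⁻¹) +
      (1 + q) * q⁻¹ ^ 3 * Y⁻¹ ^ 2 := by
    rw [firstMoment, secondMoment]
    field_simp
    ring
  rw [e, centralBound]
  have h0 := hx.1
  have h1 := hx.2
  refine add_le_add (add_le_add ?_ ?_) (le_abs_self _)
  · exact (mul_le_mul_of_nonneg_left (le_abs_self _) (sq_nonneg x)).trans
      (mul_le_mul_of_nonneg_right (pow_le_pow_left₀ h0 h1 2) (abs_nonneg _))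
  · exact (mul_le_mul_of_nonneg_left (le_abs_self _) h0).trans
      (mul_le_mul_of_nonneg_right h1 (abs_nonneg _))

/-- The bound is continuous in (q, q⁻¹, z), and at (1, 1, 0) the leading bracket is 1 - 2 + 1 = 0.
-/
theorem tendsto_centralBound (A : ℝ) {q z : ℕ → ℝ} (hq : Tendsto q atTop (𝓝 1))
    (hz : Tendsto z atTop (𝓝 0)) :
    Tendsto (fun n => centralBound A (q n) (z n)) atTop (𝓝 0) := by
  have hi : Tendsto (fun n => (q n)⁻¹) atTop (𝓝 1) := by simpa using hq.inv₀ one_ne_zero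
  have hcont : Continuous fun v : ℝ × ℝ × ℝ =>
      A ^ 2 * |v.2.1 ^ 5 + v.2.1 ^ 6 * v.2.2 - 2 * v.2.1 ^ 2 + 1| +
      A * |v.2.1 ^ 5 * v.2.2 + (2 + v.1) * v.2.1 ^ 4 * v.2.2 - 2 * v.2.1 * v.2.2| +
      |(1 + v.1) * v.2.1 ^ 3 * v.2.2 ^ 2| := by fun_prop
  have h := (hcont.tendsto (1, 1, 0)).comp (hq.prodMk_nhds (hi.prodMk_nhds hz))
  refine (h.congr fun n => rfl).trans (le_of_eq ?_)
  norm_num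

/-- For fixed M and large n, [n+p]_{q_n} ≥ [M]_{q_n}, which tends to M. -/
theorem tendsto_inv_qInt {q : ℕ → ℝ} (p : ℕ) (hq : ∀ n, 1 ≤ n → 0 < q n ∧ q n < 1)
    (h : Tendsto q atTop (𝓝 1)) :
    Tendsto (fun n => (qInt (q n) (n + p))⁻¹) atTop (𝓝 0) := by
  refine Tendsto.inv_tendsto_atTop (tendsto_atTop.2 fun b => ?_)
  obtain ⟨M, hM⟩ := exists_nat_gt b
  have hcont : Continuous fun s : ℝ => qInt s M := by unfold qInt; fun_prop
  have ht : Tendsto (fun n => qInt (q n) M) atTop (𝓝 M) := by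
    have := (hcont.tendsto 1).comp h
    simpa [qInt, Function.comp_def] using this
  filter_upwards [ht.eventually (lt_mem_nhds hM), eventually_ge_atTop (M + 1)] with n hn hnM
  refine hn.le.trans (Finset.sum_le_sum_of_subset_of_nonneg
    (Finset.range_subset_range.2 (by lia)) fun i _ _ => ?_)
  have := (hq n (by lia)).1
  positivity

theorem operator_sub_le {q a x A : ℝ} (h0 : 0 < q) (h1 : q < 1) (ha : 0 < a)
    (hx : x ∈ Set.Icc 0 A) {n p r : ℕ} (hr : n + p = r + 1) {f : ℝ → ℝ}
    (hf : WellDefinedAt q a n p f x) {ε C : ℝ} (hC : 0 ≤ C)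
    (h : ∀ t, 0 ≤ t → |f t - f x| ≤ ε + C * (t - x) ^ 2) :
    |operator q a n p f x - f x| ≤ ε + C * centralBound A q (qInt q (n + p))⁻¹ := by
  have hY : 0 < qInt q (n + p) := by rw [hr]; exact qInt_succ_pos h0 r
  have hc := mul_le_mul_of_nonneg_left (centralMoment_le h0 hY hx) hC
  -- Compare f with the parabolas f(x) ± (ε + C(t - x)²), expanded in powers of t.
  have hu := operator_mono h0 h1 ha hx.1
    (g := fun t => (f x + ε + C * x ^ 2) + (-2 * C * x) * t + C * t ^ 2)
    (fun t ht => by nlinarith [(abs_le.1 (h t ht)).2]) hf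
    (wellDefinedAt_quadratic h0 h1 ha hx.1 hr _ _ _)
  have hl := operator_mono h0 h1 ha hx.1
    (f := fun t => (f x - ε - C * x ^ 2) + (2 * C * x) * t + (-C) * t ^ 2)
    (fun t ht => by nlinarith [(abs_le.1 (h t ht)).1])
    (wellDefinedAt_quadratic h0 h1 ha hx.1 hr _ _ _) hf
  rw [operator_quadratic h0 h1 ha hx.1 hr] at hu hl
  rw [abs_le]
  constructor <;> linarith

theorem tendstoUniformlyOn_operator {p : ℕ} {a A : ℝ} (ha : 0 < a) {q : ℕ → ℝ}
    (hq : ∀ n, 1 ≤ n → 0 < q n ∧ q n < 1) (h : Tendsto q atTop (𝓝 1)) {f : ℝ → ℝ}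
    (hf : f ∈ CStar) :
    TendstoUniformlyOn (fun n x => operator (q n) a n p f x) f atTop (Set.Icc 0 A) := by
  rw [Metric.tendstoUniformlyOn_iff]
  intro ε hε
  obtain ⟨C, hC, hfC⟩ := CStar.abs_sub_le hf A (half_pos hε)
  obtain ⟨M, hM⟩ := hf.2.1
  have hlim := (tendsto_centralBound A h (tendsto_inv_qInt p hq h)).const_mul C
  rw [mul_zero] at hlim
  filter_upwards [hlim.eventually (gt_mem_nhds (half_pos hε)), eventually_ge_atTop 1] with n hn hn1 x hx
  obtain ⟨h0, h1⟩ := hq n hn1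
  have hr : n + p = (n + p - 1) + 1 := by lia
  rw [dist_comm, Real.dist_eq]
  have := operator_sub_le h0 h1 ha hx hr
    (wellDefinedAt_of_abs_le h0 h1 ha hx.1 hr hM) hC (hfC x hx)
  linarith

theorem id_mem_CStar : (fun t : ℝ => 0 + 1 * t + 0 * t ^ 2) ∈ CStar := by
  refine ⟨by fun_prop, ⟨1, fun x _ => ?_⟩, 0, ?_⟩
  · rw [abs_le]
    constructor <;> nlinarith [sq_nonneg (x - 1), sq_nonneg (x + 1)]
  · refine squeeze_zero' ?_ ?_ tendsto_inv_atTop_zero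
    · filter_upwards [eventually_gt_atTop 0] with x hx
      positivity
    · filter_upwards [eventually_gt_atTop 0] with x hx
      rw [← one_div, div_le_div_iff₀ (by positivity) hx]
      nlinarith

theorem tendsto_one_of_tendsto_operator {p : ℕ} {a A : ℝ} (ha : 0 < a) (hA : 0 < A) {q : ℕ → ℝ}
    (hq : ∀ n, 1 ≤ n → 0 < q n ∧ q n < 1)
    (h : ∀ x ∈ Set.Icc 0 A, Tendsto
      (fun n => operator (q n) a n p (fun t => 0 + 1 * t + 0 * t ^ 2) x) atTop (𝓝 x)) :
    Tendsto q atTop (𝓝 1) := by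
  have hop : ∀ x, 0 ≤ x → ∀ᶠ n in atTop,
      operator (q n) a n p (fun t => 0 + 1 * t + 0 * t ^ 2) x =
        x / q n ^ 2 + 1 / (q n * qInt (q n) (n + p)) := fun x hx => by
    filter_upwards [eventually_ge_atTop 1] with n hn
    rw [operator_quadratic (hq n hn).1 (hq n hn).2 ha hx (r := n + p - 1) (by lia), firstMoment]
    ring
  have hz := (h 0 ⟨le_rfl, hA.le⟩).congr' (hop 0 le_rfl)
  have hA' := (h A ⟨hA.le, le_rfl⟩).congr' (hop A hA.le)
  have h2 : Tendsto (fun n => (q n ^ 2)⁻¹) atTop (𝓝 1) := by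
    -- Subtracting the value at 0 removes the term 1/(q Y) and leaves A/q².
    have := (hA'.sub hz).div_const A
    rw [sub_zero, div_self hA.ne'] at this
    refine this.congr fun n => ?_
    field_simp
    ring
  have h3 : Tendsto (fun n => √(q n ^ 2)) atTop (𝓝 1) := by
    simpa using (h2.inv₀ one_ne_zero).sqrt
  refine h3.congr' ?_
  filter_upwards [eventually_ge_atTop 1] with n hn
  exact Real.sqrt_sq (hq n hn).1.le

end QBSS

end

theorem mainTheorem11 (p : ℕ) (a : ℝ) (ha : 0 < a) (A : ℝ) (hA : 0 < A)
    (q : ℕ → ℝ) (hq : ∀ n : ℕ, 1 ≤ n → 0 < q n ∧ q n < 1) :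
    (∀ f ∈ QBSS.CStar, ∀ n : ℕ, 1 ≤ n → ∀ x : ℝ, 0 ≤ x →
      QBSS.WellDefinedAt (q n) a n p f x) ∧
    ((∀ f ∈ QBSS.CStar,
        TendstoUniformlyOn (fun (n : ℕ) (x : ℝ) => QBSS.operator (q n) a n p f x) f
          Filter.atTop (Set.Icc 0 A)) ↔
      Filter.Tendsto q Filter.atTop (nhds 1)) := by
  refine ⟨fun f hf n hn x hx => ?_, fun h => ?_, fun h f hf => ?_⟩
  · obtain ⟨M, hM⟩ := hf.2.1
    exact QBSS.wellDefinedAt_of_abs_le (hq n hn).1 (hq n hn).2 ha hx (r := n + p - 1) (by lia) hM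
  · refine QBSS.tendsto_one_of_tendsto_operator (p := p) ha hA hq fun x hx => ?_
    simpa using (h _ QBSS.id_mem_CStar).tendsto_at hx
  · exact QBSS.tendstoUniformlyOn_operator ha hq h hf
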